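/- Let $\mathcal X$ be a finite set with $|\mathcal X|=N$, and let $\Delta_{\mathcal X}$ be the set of probability distributions on $\mathcal X$. For $p,q\in\Delta_{\mathcal X}$, say that $q$ is calibrated with respect to $p$ if for all $t\in[0,1]$ the level set $B_t=\{x: q_x=t\}$ satisfies $\sum_{x\in B_t}q_x=\sum_{x\in B_t}p_x$. For a function $f$ and a distribution $r$, let $\ell(q,x)=f(1/q_x)$ and $\ell(q;r)=\sum_x r_x\,\ell(q,x)$. A function $f:[1,\infty)\to\mathbb R$ is called $b(z)$-left-strongly concave if for every $z\ge 1$ the restriction of $f$ to $[1,z]$ is $b(z)$-strongly concave, i.e. $f(\lambda y+(1-\lambda)y')\ge\lambda f(y)+(1-\lambda)f(y')+\frac{b(z)}{2}\lambda(1-\lambda)(y-y')^2$ for all $y,y'\in[1,z]$ and $\lambda\in[0,1]$ (for differentiable $f$: $f(y)\le f(y')+f'(y')(y-y')-\frac{b(z)}{2}(y-y')^2$). **Theorem (Sample properness).** There is an absolute constant $c_1>0$ with the following property. Let $f:[1,\infty)\to\mathbb R$ be nonnegative, nondecreasing and concave, with $f(z)\le c\sqrt z$ for all $z\ge1$ and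 some constant $c$, and let $f$ be $\frac{C(z)}{z^2}$-left-strongly concave for some nonnegative nonincreasing $C:[1,\infty)\to\mathbb R$. Let $p,q\in\Delta_{\mathcal X}$ be such that $q$ is calibrated with respect to $p$ and $p\ne q$, write $\epsilon=\|p-q\|_1=\sum_x|p_x-q_x|$, and suppose that $C(4N/\epsilon)>0$. Let $\delta\in(0,1)$ and $$\beta=\frac{288\,N^8}{\delta\cdot\min\left(1,\left[C\!\left(\tfrac{4N}{\epsilon}\right)\frac{\epsilon^2}{128\,c}\right]^2\right)}.$$ If $m\le N$ and $$m\ \ge\ \frac{c_1\, f(\beta)^2\,\ln\frac1\delta}{\left(C\!\left(\tfrac{4N}{\epsilon}\right)\epsilon^2\right)^2},$$ and $\hat p$ is the empirical distribution of $m$ independent samples from $p$, then with probability at least $1-\delta$ $$\ell(q;\hat p)>\ell(p;\hat p).$$ -/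

import Mathlib

open MeasureTheory ProbabilityTheory Set

noncomputable section

/-- The local loss generated by `f`: outcome `x` costs the candidate `q` the amount `f (1 / q x)`. -/
def localLoss {X : Type*} (f : ℝ → ℝ) (q : X → ℝ) (x : X) : ℝ :=
  f (1 / q x)

/-- The expected loss `ℓ(q; p)`, the mean of `ℓ(q, x)` for `x` drawn from `p`. -/
def expectedLoss {X : Type*} [Fintype X] (l : (X → ℝ) → X → ℝ) (q p : X → ℝ) : ℝ :=
  ∑ x, p x * l q x

/-- The `ℓ¹` distance `‖p - q‖₁`. -/
def l1Dist {X : Type*} [Fintype X] (p q : X → ℝ) : ℝ :=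
  ∑ x, |p x - q x|

open Classical in
/-- `q` is calibrated with respect to `p`: for every `t ∈ [0, 1]`, both give the same mass to the
level set `{x | q x = t}`. -/
def IsCalibrated {X : Type*} [Fintype X] (q p : X → ℝ) : Prop :=
  ∀ t ∈ Icc (0 : ℝ) 1,
    ∑ x ∈ Finset.univ.filter (fun x => q x = t), q x =
      ∑ x ∈ Finset.univ.filter (fun x => q x = t), p x

open Classical in
/-- The empirical distribution of the sample `s 0, …, s (m - 1)`. -/
def empiricalDist {X : Type*} {m : ℕ} (s : Fin m → X) (x : X) : ℝ :=
  ((Finset.univ.filter (fun i => s i = x)).card : ℝ) / m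

/-- `f` is `b(z)`-left-strongly concave on the domain `D`: for each `z ∈ D`, the restriction of `f`
to the part of `D` at or below `z` is `b z`-strongly concave. For differentiable `f` this is the
inequality `f y ≤ f y' + f' y' * (y - y') - b z / 2 * (y - y') ^ 2` for `y, y' ≤ z` in `D`. -/
def LeftStronglyConcaveOn (D : Set ℝ) (b f : ℝ → ℝ) : Prop :=
  ∀ z ∈ D, StrongConcaveOn (D ∩ Iic z) (b z) f

/-- The number `β = 288 N⁸ / (δ · min (1, [C(4N/ε) · ε² / (128 c)]²))`. -/
def sampleBeta (C : ℝ → ℝ) (c : ℝ) (N : ℕ) (ε δ : ℝ) : ℝ :=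
  288 * (N : ℝ) ^ 8 / (δ * min 1 ((C (4 * N / ε) * (ε ^ 2 / (128 * c))) ^ 2))

end

/-!
Calibration says that `p` and `q` give the same sum to every function of `q x`. Concavity of `f`
bounds `p x * (f (1 / q x) - f (1 / p x))` below by an affine function of `p x` with coefficients
depending on `q x` only, plus a quadratic term from strong concavity. The affine parts cancel in
the sum, and the quadratic parts on the outcomes with `p x > q x ≥ ε / 4N` add up to a multiple of
`C (4N / ε) * ε ^ 2`.

The excess loss of a single draw is unbounded, so one truncates to the outcomes of mass at least
`1 / β` under both `p` and `q`. There it is at most `f β` in absolute value. The other outcomes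
contribute little to the mean, because `r * f (1 / r) ≤ c * √r`, and they are unlikely to show up
among `m ≤ N` samples. Conditionally on seeing only heavy outcomes the draws are still independent,
and Hoeffding's inequality applies. The resulting bound is a product rather than a union bound,
which matters for `δ` close to `1`.
-/

section Calibration

variable {X : Type*} [Fintype X] {p q : X → ℝ}

theorem l1Dist_pos (hne : p ≠ q) : 0 < l1Dist p q := by
  obtain ⟨x, hx⟩ := Function.ne_iff.1 hne
  exact Finset.sum_pos' (fun _ _ => abs_nonneg _)
    ⟨x, Finset.mem_univ x, abs_pos.2 (sub_ne_zero.2 hx)⟩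

theorem sum_filter_lt_sub_eq_l1Dist_div_two (hpq : ∑ x, p x = ∑ x, q x) :
    ∑ x with q x < p x, (p x - q x) = l1Dist p q / 2 := by
  have hpart (x : X) :
      (if q x < p x then p x - q x else 0) = ((p x - q x) + |p x - q x|) / 2 := by
    split_ifs with h
    · rw [abs_of_pos (sub_pos.2 h)]; ring
    · rw [abs_of_nonpos (sub_nonpos.2 (not_lt.1 h))]; ring
  rw [Finset.sum_filter, Finset.sum_congr rfl fun x _ => hpart x, ← Finset.sum_div,
    Finset.sum_add_distrib, Finset.sum_sub_distrib, hpq, sub_self, zero_add, l1Dist]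

theorem sum_le_card_univ_mul (s : Finset X) {h : X → ℝ} {B : ℝ} (hB : 0 ≤ B)
    (hle : ∀ x ∈ s, h x ≤ B) : ∑ x ∈ s, h x ≤ Fintype.card X * B := by
  refine (Finset.sum_le_card_nsmul s h B hle).trans ?_
  rw [nsmul_eq_mul]
  gcongr
  exact Finset.card_le_univ s

namespace IsCalibrated

theorem sum_mul_comp_eq (h : IsCalibrated q p) (hq : ∀ x, q x ∈ Icc (0 : ℝ) 1) (φ : ℝ → ℝ) :
    ∑ x, p x * φ (q x) = ∑ x, q x * φ (q x) := by
  have sum_by_level (r : X → ℝ) : ∑ x, r x * φ (q x) =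
      ∑ t ∈ Finset.univ.image q, (∑ x with q x = t, r x) * φ t := by
    rw [← Finset.sum_fiberwise_of_maps_to fun x _ => Finset.mem_image_of_mem q (Finset.mem_univ x)]
    refine Finset.sum_congr rfl fun t _ => ?_
    rw [Finset.sum_mul]
    exact Finset.sum_congr rfl fun x hx => by rw [(Finset.mem_filter.1 hx).2]
  rw [sum_by_level, sum_by_level]
  refine Finset.sum_congr rfl fun t ht => ?_
  obtain ⟨x, -, rfl⟩ := Finset.mem_image.1 ht
  have hlevel := h (q x) (hq x)
  congr 1
  convert hlevel.symm

theorem sum_filter_mul_comp_eq (h : IsCalibrated q p) (hq : ∀ x, q x ∈ Icc (0 : ℝ) 1)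
    (s : ℝ → Prop) [DecidablePred s] (φ : ℝ → ℝ) :
    ∑ x with s (q x), p x * φ (q x) = ∑ x with s (q x), q x * φ (q x) := by
  have := h.sum_mul_comp_eq hq fun t => if s t then φ t else 0
  simpa only [mul_ite, mul_zero, ← Finset.sum_filter] using this

theorem sum_filter_eq (h : IsCalibrated q p) (hq : ∀ x, q x ∈ Icc (0 : ℝ) 1)
    (s : ℝ → Prop) [DecidablePred s] : ∑ x with s (q x), p x = ∑ x with s (q x), q x := by
  simpa only [mul_one] using h.sum_filter_mul_comp_eq hq s fun _ => 1

theorem eq_zero_of_eq_zero (h : IsCalibrated q p) (hp : ∀ x, 0 ≤ p x)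
    (hq : ∀ x, q x ∈ Icc (0 : ℝ) 1) {x : X} (hx : q x = 0) : p x = 0 := by
  have hsum : ∑ y with q y = 0, p y = 0 := by
    rw [h.sum_filter_eq hq (· = 0)]
    exact Finset.sum_eq_zero fun y hy => (Finset.mem_filter.1 hy).2
  exact (Finset.sum_eq_zero_iff_of_nonneg fun y _ => hp y).1 hsum x (by simp [hx])

theorem lt_one (h : IsCalibrated q p) (hp : p ∈ stdSimplex ℝ X) (hq : q ∈ stdSimplex ℝ X)
    (hne : p ≠ q) (x : X) : q x < 1 := by
  classical
  refine (mem_Icc_of_mem_stdSimplex hq x).2.lt_of_ne fun hx => hne ?_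
  have hq_off (y : X) (hy : y ≠ x) : q y = 0 := by
    have hrest := Finset.sum_erase_eq_sub (f := q) (Finset.mem_univ x)
    rw [hq.2, hx, sub_self] at hrest
    exact (Finset.sum_eq_zero_iff_of_nonneg fun z _ => hq.1 z).1 hrest y (by simp [hy])
  have hp_off (y : X) (hy : y ≠ x) : p y = 0 :=
    h.eq_zero_of_eq_zero hp.1 (mem_Icc_of_mem_stdSimplex hq) (hq_off y hy)
  have hpx : p x = 1 := by
    rw [← hp.2, Finset.sum_eq_single x (fun y _ hy => hp_off y hy) (by simp)]
  ext y
  obtain rfl | hy := eq_or_ne y x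
  · rw [hpx, hx]
  · rw [hq_off y hy, hp_off y hy]

theorem sum_filter_lt_le_card_mul (h : IsCalibrated q p) (hq : ∀ x, q x ∈ Icc (0 : ℝ) 1)
    {θ : ℝ} (hθ : 0 ≤ θ) : ∑ x with q x < θ, p x ≤ Fintype.card X * θ := by
  rw [h.sum_filter_eq hq (· < θ)]
  exact sum_le_card_univ_mul _ hθ fun x hx => (Finset.mem_filter.1 hx).2.le

theorem l1Dist_div_two_sub_le_sum (h : IsCalibrated q p) (hp : p ∈ stdSimplex ℝ X)
    (hq : q ∈ stdSimplex ℝ X) {θ : ℝ} (hθ : 0 ≤ θ) :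
    l1Dist p q / 2 - Fintype.card X * θ ≤ ∑ x with q x < p x ∧ θ ≤ q x, (p x - q x) := by
  rw [← sum_filter_lt_sub_eq_l1Dist_div_two (hp.2.trans hq.2.symm), sub_le_iff_le_add]
  refine le_trans ?_ (add_le_add_right
    (h.sum_filter_lt_le_card_mul (mem_Icc_of_mem_stdSimplex hq) hθ) _)
  simp only [Finset.sum_filter, ← Finset.sum_add_distrib]
  refine Finset.sum_le_sum fun x _ => ?_
  have := hp.1 x
  have := hq.1 x
  split_ifs <;> grind

end IsCalibrated

end Calibration

section Concave

theorem le_add_rightDeriv_mul_sub {f : ℝ → ℝ} {s : Set ℝ} (hf : ConcaveOn ℝ s f) {a y : ℝ}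
    (ha : a ∈ interior s) (hy : y ∈ s) : f y ≤ f a + derivWithin f (Ioi a) a * (y - a) := by
  have hneg : derivWithin (-f) (Ioi a) a = -derivWithin f (Ioi a) a := derivWithin.neg
  obtain hlt | rfl | hgt := lt_trichotomy y a
  · have hslope := (hf.neg.slope_le_leftDeriv_of_mem_interior hy ha hlt).trans
      (hf.neg.leftDeriv_le_rightDeriv_of_mem_interior ha)
    rw [slope_def_field, div_le_iff₀ (sub_pos.2 hlt), hneg] at hslope
    simp only [Pi.neg_apply] at hslope
    linarith
  · simp
  · have hslope := hf.neg.rightDeriv_le_slope_of_mem_interior ha hy hgt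
    rw [slope_def_field, le_div_iff₀ (sub_pos.2 hgt), hneg] at hslope
    simp only [Pi.neg_apply] at hslope
    linarith

-- Comparing `f` with its affine majorant at the midpoint of `a` and `y` costs a factor `2` over
-- the optimal constant `b / 2`, but needs no limiting argument.
theorem le_sub_mul_norm_sq_of_strongConcaveOn {E : Type*} [NormedAddCommGroup E] [NormedSpace ℝ E]
    {f : E → ℝ} {s : Set E} {b : ℝ} (hf : StrongConcaveOn s b f) {a y : E} (g : E →ₗ[ℝ] ℝ)
    (hg : ∀ z ∈ s, f z ≤ f a + g (z - a)) (ha : a ∈ s) (hy : y ∈ s) :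
    f y ≤ f a + g (y - a) - b / 4 * ‖y - a‖ ^ 2 := by
  have half : (0 : ℝ) ≤ 1 / 2 := by norm_num
  have hmid := hf.2 hy ha half half (by norm_num)
  have hmajor := hg _ (hf.1 hy ha half half (by norm_num))
  have hsub : (1 / 2 : ℝ) • y + (1 / 2 : ℝ) • a - a = (1 / 2 : ℝ) • (y - a) := by module
  rw [hsub, map_smul] at hmajor
  simp only [smul_eq_mul] at hmid hmajor
  linarith

end Concave

section Properness

/-- The excess of the local loss of the candidate `q` over that of `p`. -/
noncomputable def excessLoss {X : Type*} (f : ℝ → ℝ) (p q : X → ℝ) (x : X) : ℝ :=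
  localLoss f q x - localLoss f p x

/-- The slope at `r = t` of an affine minorant of `r ↦ r * (f (1 / t) - f (1 / r))`, for concave
`f`. The right derivative makes it available without differentiability of `f`. -/
noncomputable def gapSlope (f : ℝ → ℝ) (t : ℝ) : ℝ :=
  derivWithin f (Ioi (1 / t)) (1 / t) / t

variable {f C : ℝ → ℝ}

theorem one_lt_one_div_of_mem_Ioo {t : ℝ} (ht : t ∈ Ioo (0 : ℝ) 1) : 1 < 1 / t :=
  (one_lt_div ht.1).2 ht.2

theorem one_le_one_div_of_mem_Ioc {t : ℝ} (ht : t ∈ Ioc (0 : ℝ) 1) : 1 ≤ 1 / t :=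
  (one_le_div ht.1).2 ht.2

theorem div_mul_sub_add_mul_le {r t g e : ℝ} (hr : 0 < r) (ht : 0 < t)
    (h : f (1 / r) ≤ f (1 / t) + g * (1 / r - 1 / t) - e) :
    g / t * (r - t) + r * e ≤ r * (f (1 / t) - f (1 / r)) := by
  have hscaled := mul_le_mul_of_nonneg_left h hr.le
  have hslope : r * (g * (1 / r - 1 / t)) = -(g / t * (r - t)) := by field_simp; ring
  linarith

theorem gapSlope_mul_sub_le (hmono : MonotoneOn f (Ici 1)) (hconc : ConcaveOn ℝ (Ici 1) f)
    {t r : ℝ} (ht : t ∈ Ioo (0 : ℝ) 1) (hr : r ∈ Icc (0 : ℝ) 1) :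
    gapSlope f t * (r - t) ≤ r * (f (1 / t) - f (1 / r)) := by
  have ha := one_lt_one_div_of_mem_Ioo ht
  obtain rfl | hr0 := hr.1.eq_or_lt
  · have hslope : 0 ≤ gapSlope f t :=
      div_nonneg (hmono.mono fun y hy => ha.le.trans (mem_Ioi.1 hy).le).derivWithin_nonneg ht.1.le
    rw [zero_mul]
    exact mul_nonpos_of_nonneg_of_nonpos hslope (by linarith [ht.1])
  · have hsuper := le_add_rightDeriv_mul_sub hconc (a := 1 / t) (by rwa [interior_Ici])
      (one_le_one_div_of_mem_Ioc ⟨hr0, hr.2⟩)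
    simpa only [gapSlope, mul_zero, add_zero] using
      div_mul_sub_add_mul_le (e := 0) hr0 ht.1 (hsuper.trans_eq (sub_zero _).symm)

theorem gapSlope_mul_sub_add_le (hconc : ConcaveOn ℝ (Ici 1) f)
    (hstrong : LeftStronglyConcaveOn (Ici 1) (fun z => C z / z ^ 2) f) {t r : ℝ} (ht : 0 < t)
    (htr : t < r) (hr : r ≤ 1) :
    gapSlope f t * (r - t) + C (1 / t) / 4 * ((r - t) ^ 2 / r) ≤ r * (f (1 / t) - f (1 / r)) := by
  have hr0 : 0 < r := ht.trans htr
  have ha := one_lt_one_div_of_mem_Ioo ⟨ht, htr.trans_le hr⟩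
  have hsuper (y : ℝ) (hy : y ∈ Ici (1 : ℝ) ∩ Iic (1 / t)) :=
    le_add_rightDeriv_mul_sub hconc (a := 1 / t) (by rwa [interior_Ici]) hy.1
  have hstrict := le_sub_mul_norm_sq_of_strongConcaveOn (hstrong (1 / t) ha.le)
    (LinearMap.mulLeft ℝ (derivWithin f (Ioi (1 / t)) (1 / t))) hsuper ⟨ha.le, le_refl (1 / t)⟩
    ⟨one_le_one_div_of_mem_Ioc ⟨hr0, hr⟩, one_div_le_one_div_of_le ht htr.le⟩
  have hquad : r * (C (1 / t) / (1 / t) ^ 2 / 4 * ‖1 / r - 1 / t‖ ^ 2) =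
      C (1 / t) / 4 * ((r - t) ^ 2 / r) := by
    rw [Real.norm_eq_abs, sq_abs]; field_simp; ring
  rw [← hquad]
  exact div_mul_sub_add_mul_le hr0 ht hstrict

variable {X : Type*} [Fintype X] {p q : X → ℝ}

theorem sq_sum_le_sum_sq_div (hp : p ∈ stdSimplex ℝ X) {s : Finset X} (hs : ∀ x ∈ s, 0 < p x)
    (h : X → ℝ) : (∑ x ∈ s, h x) ^ 2 ≤ ∑ x ∈ s, h x ^ 2 / p x := by
  obtain rfl | hne := s.eq_empty_or_nonempty
  · simp
  have hmass : ∑ x ∈ s, p x ≤ 1 :=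
    hp.2 ▸ Finset.sum_le_univ_sum_of_nonneg hp.1
  exact (le_div_self (sq_nonneg _) (Finset.sum_pos hs hne) hmass).trans
    (Finset.sq_sum_div_le_sum_sq_div s _ hs)

-- Summed over `x`, the affine terms `gapSlope f (q x) * (p x - q x)` cancel by calibration.
theorem mul_sq_sum_le_sum_mul_excessLoss (hmono : MonotoneOn f (Ici 1))
    (hconc : ConcaveOn ℝ (Ici 1) f) (hC : AntitoneOn C (Ici 1))
    (hstrong : LeftStronglyConcaveOn (Ici 1) (fun z => C z / z ^ 2) f)
    (hp : p ∈ stdSimplex ℝ X) (hq : q ∈ stdSimplex ℝ X) (hcal : IsCalibrated q p) (hne : p ≠ q)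
    {θ : ℝ} (hθ : 0 < θ) (hCθ : 0 ≤ C (1 / θ)) :
    C (1 / θ) / 4 * (∑ x with q x < p x ∧ θ ≤ q x, (p x - q x)) ^ 2 ≤
      ∑ x, p x * excessLoss f p q x := by
  have hqI := mem_Icc_of_mem_stdSimplex hq
  have hpointwise (x : X) : gapSlope f (q x) * (p x - q x) +
      (if q x < p x ∧ θ ≤ q x then C (1 / θ) / 4 * ((p x - q x) ^ 2 / p x) else 0) ≤
        p x * excessLoss f p q x := by
    split_ifs with hx
    · have hq0 : 0 < q x := hθ.trans_le hx.2
      have hCq : C (1 / θ) ≤ C (1 / q x) := by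
        have ha := one_le_one_div_of_mem_Ioc ⟨hq0, (hqI x).2⟩
        have hle := one_div_le_one_div_of_le hθ hx.2
        exact hC ha (ha.trans hle) hle
      refine le_trans ?_ (gapSlope_mul_sub_add_le hconc hstrong hq0 hx.1
        (mem_Icc_of_mem_stdSimplex hp x).2)
      have := hp.1 x
      gcongr
    · rw [add_zero]
      obtain hq0 | hq0 := (hq.1 x).eq_or_lt
      · simp [hcal.eq_zero_of_eq_zero hp.1 hqI hq0.symm, ← hq0]
      · exact gapSlope_mul_sub_le hmono hconc ⟨hq0, hcal.lt_one hp hq hne x⟩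
          (mem_Icc_of_mem_stdSimplex hp x)
  have hcancel : ∑ x, gapSlope f (q x) * (p x - q x) = 0 := by
    simp_rw [mul_comm (gapSlope f _), sub_mul, Finset.sum_sub_distrib,
      hcal.sum_mul_comp_eq hqI (gapSlope f), sub_self]
  have hsum := Finset.sum_le_sum fun x (_ : x ∈ Finset.univ) => hpointwise x
  rw [Finset.sum_add_distrib, hcancel, zero_add, ← Finset.sum_filter, ← Finset.mul_sum] at hsum
  refine le_trans ?_ hsum
  gcongr
  exact sq_sum_le_sum_sq_div hp (fun x hx => (hq.1 x).trans_lt (Finset.mem_filter.1 hx).2.1) _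

theorem strong_properness (hmono : MonotoneOn f (Ici 1)) (hconc : ConcaveOn ℝ (Ici 1) f)
    (hC : AntitoneOn C (Ici 1))
    (hstrong : LeftStronglyConcaveOn (Ici 1) (fun z => C z / z ^ 2) f)
    (hp : p ∈ stdSimplex ℝ X) (hq : q ∈ stdSimplex ℝ X) (hcal : IsCalibrated q p) (hne : p ≠ q)
    (hC0 : 0 ≤ C (4 * Fintype.card X / l1Dist p q)) :
    C (4 * Fintype.card X / l1Dist p q) * l1Dist p q ^ 2 / 64 ≤
      ∑ x, p x * excessLoss f p q x := by
  have hε : 0 < l1Dist p q := l1Dist_pos hne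
  obtain ⟨x, -⟩ := Function.ne_iff.1 hne
  have hN : (0 : ℝ) < Fintype.card X := Nat.cast_pos.2 (Fintype.card_pos_iff.2 ⟨x⟩)
  set θ := l1Dist p q / (4 * Fintype.card X) with hθ
  have hθ0 : 0 < θ := by positivity
  have hθinv : 4 * (Fintype.card X : ℝ) / l1Dist p q = 1 / θ := by rw [hθ, one_div_div]
  rw [hθinv] at hC0 ⊢
  have hmass : l1Dist p q / 4 ≤ ∑ x with q x < p x ∧ θ ≤ q x, (p x - q x) := by
    have hlight : Fintype.card X * θ = l1Dist p q / 4 := by rw [hθ]; field_simp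
    linarith [hcal.l1Dist_div_two_sub_le_sum hp hq hθ0.le]
  calc C (1 / θ) * l1Dist p q ^ 2 / 64 = C (1 / θ) / 4 * (l1Dist p q / 4) ^ 2 := by ring
    _ ≤ C (1 / θ) / 4 * (∑ x with q x < p x ∧ θ ≤ q x, (p x - q x)) ^ 2 := by gcongr
    _ ≤ _ := mul_sq_sum_le_sum_mul_excessLoss hmono hconc hC hstrong hp hq hcal hne hθ0 hC0

end Properness

section Truncation

variable {X : Type*} {f : ℝ → ℝ} {p q : X → ℝ} {c θ : ℝ}

theorem mul_one_div_le_mul_sqrt (hf : ∀ z ∈ Ici (1 : ℝ), f z ≤ c * √z) {r : ℝ}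
    (hr : r ∈ Icc (0 : ℝ) 1) : r * f (1 / r) ≤ c * √r := by
  obtain rfl | hr0 := hr.1.eq_or_lt
  · simp
  · calc r * f (1 / r) ≤ r * (c * √(1 / r)) := by
          gcongr
          exact hf _ (one_le_one_div_of_mem_Ioc ⟨hr0, hr.2⟩)
      _ = c * √r := by
          rw [one_div, Real.sqrt_inv, mul_left_comm, ← div_eq_mul_inv, Real.div_sqrt]

theorem mul_excessLoss_le (hf0 : ∀ z ∈ Ici (1 : ℝ), 0 ≤ f z) {x : X}
    (hpx : p x ∈ Icc (0 : ℝ) 1) : p x * excessLoss f p q x ≤ p x * f (1 / q x) := by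
  obtain h0 | h0 := hpx.1.eq_or_lt
  · simp [← h0]
  · have := hf0 _ (one_le_one_div_of_mem_Ioc ⟨h0, hpx.2⟩)
    exact mul_le_mul_of_nonneg_left (sub_le_self _ this) h0.le

variable [Fintype X]

/-- The outcomes to which both `p` and `q` assign mass at least `θ`. -/
noncomputable def heavyOutcomes (p q : X → ℝ) (θ : ℝ) : Finset X :=
  {x | θ ≤ p x ∧ θ ≤ q x}

theorem mem_heavyOutcomes {x : X} : x ∈ heavyOutcomes p q θ ↔ θ ≤ p x ∧ θ ≤ q x := by
  simp [heavyOutcomes]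

theorem sum_eq_sum_heavyOutcomes_add (h : X → ℝ) :
    ∑ x, h x = ∑ x ∈ heavyOutcomes p q θ, h x + ∑ x with q x < θ, h x +
      ∑ x with p x < θ ∧ θ ≤ q x, h x := by
  simp only [heavyOutcomes, Finset.sum_filter, ← Finset.sum_add_distrib]
  refine Finset.sum_congr rfl fun x _ => ?_
  split_ifs <;> grind

theorem one_sub_le_sum_heavyOutcomes (hcal : IsCalibrated q p) (hp : p ∈ stdSimplex ℝ X)
    (hq : q ∈ stdSimplex ℝ X) (hθ : 0 ≤ θ) :
    1 - 2 * Fintype.card X * θ ≤ ∑ x ∈ heavyOutcomes p q θ, p x := by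
  have hq_light := hcal.sum_filter_lt_le_card_mul (mem_Icc_of_mem_stdSimplex hq) hθ
  have hp_light : ∑ x with p x < θ ∧ θ ≤ q x, p x ≤ Fintype.card X * θ :=
    sum_le_card_univ_mul _ hθ fun x hx => (Finset.mem_filter.1 hx).2.1.le
  have := sum_eq_sum_heavyOutcomes_add (p := p) (q := q) (θ := θ) p
  rw [hp.2] at this
  linarith

theorem abs_excessLoss_le (hf0 : ∀ z ∈ Ici (1 : ℝ), 0 ≤ f z) (hmono : MonotoneOn f (Ici 1))
    (hp : p ∈ stdSimplex ℝ X) (hq : q ∈ stdSimplex ℝ X) (hθ : 0 < θ) {x : X}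
    (hx : x ∈ heavyOutcomes p q θ) : |excessLoss f p q x| ≤ f (1 / θ) := by
  have hloss {r : ℝ} (hθr : θ ≤ r) (hr : r ≤ 1) : f (1 / r) ∈ Icc 0 (f (1 / θ)) := by
    have ha := one_le_one_div_of_mem_Ioc ⟨hθ.trans_le hθr, hr⟩
    have hle := one_div_le_one_div_of_le hθ hθr
    exact ⟨hf0 _ ha, hmono ha (ha.trans hle) hle⟩
  obtain ⟨hpx, hqx⟩ := mem_heavyOutcomes.1 hx
  have hq1 := (mem_Icc_of_mem_stdSimplex hq x).2
  have hp1 := (mem_Icc_of_mem_stdSimplex hp x).2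
  exact abs_sub_le_of_nonneg_of_le (hloss hqx hq1).1 (hloss hqx hq1).2 (hloss hpx hp1).1
    (hloss hpx hp1).2

theorem pos_of_sum_mul_excessLoss_pos (hf0 : ∀ z ∈ Ici (1 : ℝ), 0 ≤ f z)
    (hf : ∀ z ∈ Ici (1 : ℝ), f z ≤ c * √z) (hp : p ∈ stdSimplex ℝ X) (hq : q ∈ stdSimplex ℝ X)
    (hcal : IsCalibrated q p) (hpos : 0 < ∑ x, p x * excessLoss f p q x) : 0 < c := by
  have hqI := mem_Icc_of_mem_stdSimplex hq
  have hupper : ∑ x, p x * excessLoss f p q x ≤ c * ∑ x, √(q x) :=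
    calc ∑ x, p x * excessLoss f p q x ≤ ∑ x, p x * f (1 / q x) :=
          Finset.sum_le_sum fun x _ => mul_excessLoss_le hf0 (mem_Icc_of_mem_stdSimplex hp x)
      _ = ∑ x, q x * f (1 / q x) := hcal.sum_mul_comp_eq hqI fun t => f (1 / t)
      _ ≤ c * ∑ x, √(q x) := by
          rw [Finset.mul_sum]
          exact Finset.sum_le_sum fun x _ => mul_one_div_le_mul_sqrt hf (hqI x)
  exact pos_of_mul_pos_left (hpos.trans_le hupper) (Finset.sum_nonneg fun _ _ => Real.sqrt_nonneg _)

theorem sum_filter_mul_excessLoss_le_of_candidate_lt (hf0 : ∀ z ∈ Ici (1 : ℝ), 0 ≤ f z)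
    (hf : ∀ z ∈ Ici (1 : ℝ), f z ≤ c * √z) (hc : 0 ≤ c) (hp : p ∈ stdSimplex ℝ X)
    (hq : q ∈ stdSimplex ℝ X) (hcal : IsCalibrated q p) :
    ∑ x with q x < θ, p x * excessLoss f p q x ≤ Fintype.card X * (c * √θ) := by
  have hqI := mem_Icc_of_mem_stdSimplex hq
  calc ∑ x with q x < θ, p x * excessLoss f p q x ≤ ∑ x with q x < θ, p x * f (1 / q x) :=
        Finset.sum_le_sum fun x _ => mul_excessLoss_le hf0 (mem_Icc_of_mem_stdSimplex hp x)
    _ = ∑ x with q x < θ, q x * f (1 / q x) :=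
        hcal.sum_filter_mul_comp_eq hqI (· < θ) fun t => f (1 / t)
    _ ≤ Fintype.card X * (c * √θ) := by
        refine sum_le_card_univ_mul _ (by positivity) fun x hx => ?_
        refine (mul_one_div_le_mul_sqrt hf (hqI x)).trans ?_
        gcongr
        exact (Finset.mem_filter.1 hx).2.le

theorem sum_filter_mul_excessLoss_le_of_lt_le (hf0 : ∀ z ∈ Ici (1 : ℝ), 0 ≤ f z)
    (hmono : MonotoneOn f (Ici 1)) (hf : ∀ z ∈ Ici (1 : ℝ), f z ≤ c * √z) (hc : 0 ≤ c)
    (hp : p ∈ stdSimplex ℝ X) (hq : q ∈ stdSimplex ℝ X) (hθ : 0 < θ) :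
    ∑ x with p x < θ ∧ θ ≤ q x, p x * excessLoss f p q x ≤ Fintype.card X * (c * √θ) := by
  refine sum_le_card_univ_mul _ (by positivity) fun x hx => ?_
  obtain ⟨-, hpx, hqx⟩ := Finset.mem_filter.1 hx
  have hq1 := (mem_Icc_of_mem_stdSimplex hq x).2
  have ha := one_le_one_div_of_mem_Ioc ⟨hθ.trans_le hqx, hq1⟩
  have hle := one_div_le_one_div_of_le hθ hqx
  calc p x * excessLoss f p q x ≤ p x * f (1 / q x) :=
        mul_excessLoss_le hf0 (mem_Icc_of_mem_stdSimplex hp x)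
    _ ≤ θ * f (1 / θ) := by
        have := hf0 _ ha
        have := hmono ha (ha.trans hle) hle
        gcongr
    _ ≤ c * √θ := mul_one_div_le_mul_sqrt hf ⟨hθ.le, hqx.trans hq1⟩

theorem sum_mul_excessLoss_sub_le (hf0 : ∀ z ∈ Ici (1 : ℝ), 0 ≤ f z)
    (hmono : MonotoneOn f (Ici 1)) (hf : ∀ z ∈ Ici (1 : ℝ), f z ≤ c * √z) (hc : 0 ≤ c)
    (hp : p ∈ stdSimplex ℝ X) (hq : q ∈ stdSimplex ℝ X) (hcal : IsCalibrated q p) (hθ : 0 < θ) :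
    ∑ x, p x * excessLoss f p q x - 2 * Fintype.card X * c * √θ ≤
      ∑ x ∈ heavyOutcomes p q θ, p x * excessLoss f p q x := by
  have hsplit := sum_eq_sum_heavyOutcomes_add (p := p) (q := q) (θ := θ)
    fun x => p x * excessLoss f p q x
  have hq_light := sum_filter_mul_excessLoss_le_of_candidate_lt (θ := θ) hf0 hf hc hp hq hcal
  have hp_light := sum_filter_mul_excessLoss_le_of_lt_le hf0 hmono hf hc hp hq hθ
  linarith

end Truncation

section Sampling

section Hoeffding

variable {Ω ι : Type*} [MeasurableSpace Ω] {μ : Measure Ω} [Fintype ι]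

theorem measureReal_sum_nonpos_le_exp [IsProbabilityMeasure μ] {X : ι → Ω → ℝ}
    (hmeas : ∀ i, AEMeasurable (X i) μ) (hindep : iIndepFun X μ) {B d : ℝ} (hd : 0 ≤ d)
    (hB : ∀ i, ∀ᵐ ω ∂μ, |X i ω| ≤ B) (hmean : ∀ i, d ≤ ∫ ω, X i ω ∂μ) :
    μ.real {ω | ∑ i, X i ω ≤ 0} ≤ Real.exp (-(Fintype.card ι * (d ^ 2 / (2 * B ^ 2)))) := by
  set c : NNReal := (‖B - -B‖₊ / 2) ^ 2 with hc
  have hcB : (c : ℝ) = B ^ 2 := by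
    rw [hc, NNReal.coe_pow, NNReal.coe_div, coe_nnnorm, Real.norm_eq_abs, NNReal.coe_ofNat,
      sub_neg_eq_add, ← two_mul, abs_mul, abs_two, mul_div_cancel_left₀ _ two_ne_zero, sq_abs]
  have hsub (i : ι) : HasSubgaussianMGF (fun ω => ∫ ω, X i ω ∂μ - X i ω) c μ := by
    refine (hasSubgaussianMGF_of_mem_Icc (hmeas i)
      ((hB i).mono fun ω hω => abs_le.1 hω)).neg.congr (ae_of_all _ fun ω => ?_)
    simp only [Pi.neg_apply, neg_sub]
  have hindep' : iIndepFun (fun i ω => ∫ ω, X i ω ∂μ - X i ω) μ :=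
    hindep.comp (fun i x => ∫ ω, X i ω ∂μ - x) fun i => measurable_const.sub measurable_id
  calc μ.real {ω | ∑ i, X i ω ≤ 0}
      ≤ μ.real {ω | Fintype.card ι * d ≤ ∑ i, (∫ ω, X i ω ∂μ - X i ω)} := by
        refine measureReal_mono fun ω (hω : ∑ i, X i ω ≤ 0) => ?_
        have := Finset.card_nsmul_le_sum Finset.univ _ d fun i _ => hmean i
        rw [nsmul_eq_mul, Finset.card_univ] at this
        rw [mem_ofPred_eq, Finset.sum_sub_distrib]
        linarith
    _ ≤ Real.exp (-(Fintype.card ι * d) ^ 2 / (2 * ∑ _i : ι, (c : ℝ))) :=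
        mod_cast HasSubgaussianMGF.measure_sum_ge_le_of_iIndepFun hindep' (fun i _ => hsub i)
          (by positivity)
    _ = Real.exp (-(Fintype.card ι * (d ^ 2 / (2 * B ^ 2)))) := by
        rw [hcB, Finset.sum_const, nsmul_eq_mul, Finset.card_univ]
        obtain hι | hι := eq_or_ne (Fintype.card ι : ℝ) 0
        · simp [hι]
        · obtain rfl | hB0 := eq_or_ne B 0
          · simp
          · congr 1; field_simp

end Hoeffding

section Conditioning

variable {Ω ι E : Type*} [MeasurableSpace Ω] {μ : Measure Ω} [MeasurableSpace E] {S : ι → Ω → E}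
  {G : Set E}

theorem iIndepFun_prodMk_self (hindep : iIndepFun S μ) :
    iIndepFun (fun i ω => (S i ω, S i ω)) μ :=
  hindep.comp (fun _ x => (x, x)) fun _ => measurable_id.prodMk measurable_id

theorem integral_comp_cond_iInter [Finite ι] (hS : ∀ i, Measurable (S i)) (hindep : iIndepFun S μ)
    (hG : MeasurableSet G) (hpos : ∀ i, μ (S i ⁻¹' G) ≠ 0) {φ : E → ℝ} (hφ : Measurable φ)
    (i : ι) :
    ∫ ω, φ (S i ω) ∂μ[|⋂ j, S j ⁻¹' G] =
      (∫ ω in S i ⁻¹' G, φ (S i ω) ∂μ) / μ.real (S i ⁻¹' G) := by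
  have hlaw : (μ[|⋂ j, S j ⁻¹' G]).map (S i) = (μ[|S i ⁻¹' G]).map (S i) := by
    ext A hA
    rw [Measure.map_apply (hS i) hA, Measure.map_apply (hS i) hA]
    simpa using cond_iInter (s := {i}) (f := fun _ => S i ⁻¹' A) (t := fun _ => G) hS
      (iIndepFun_prodMk_self hindep) (fun j hj => Finset.mem_singleton.1 hj ▸ ⟨A, hA, rfl⟩)
      (fun j _ => hpos j) fun _ => hG
  rw [← integral_map (hS i).aemeasurable hφ.aestronglyMeasurable, hlaw,
    integral_map (hS i).aemeasurable hφ.aestronglyMeasurable, ProbabilityTheory.cond,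
    integral_smul_measure, ENNReal.toReal_inv, smul_eq_mul, inv_mul_eq_div, measureReal_def]

variable [Fintype ι] [IsProbabilityMeasure μ]

theorem one_sub_exp_le_cond_real_sum_pos (hS : ∀ i, Measurable (S i)) (hindep : iIndepFun S μ)
    (hG : MeasurableSet G) (hpos : ∀ i, μ (S i ⁻¹' G) ≠ 0) {φ : E → ℝ} (hφ : Measurable φ)
    {B d : ℝ} (hd : 0 ≤ d) (hB : ∀ x ∈ G, |φ x| ≤ B)
    (hmean : ∀ i, d * μ.real (S i ⁻¹' G) ≤ ∫ ω in S i ⁻¹' G, φ (S i ω) ∂μ) :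
    1 - Real.exp (-(Fintype.card ι * (d ^ 2 / (2 * B ^ 2)))) ≤
      (μ[|⋂ i, S i ⁻¹' G]).real {ω | 0 < ∑ i, φ (S i ω)} := by
  have hindepG : iIndepFun S μ[|⋂ i, S i ⁻¹' G] :=
    iIndepFun.cond hS (iIndepFun_prodMk_self hindep) hpos fun _ => hG
  have := hindepG.isProbabilityMeasure
  have hbound (i : ι) : ∀ᵐ ω ∂μ[|⋂ i, S i ⁻¹' G], |φ (S i ω)| ≤ B :=
    (ae_cond_mem (.iInter fun i => hS i hG)).mono fun ω hω => hB _ (mem_iInter.1 hω i)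
  have hcondmean (i : ι) : d ≤ ∫ ω, φ (S i ω) ∂μ[|⋂ i, S i ⁻¹' G] := by
    have hGpos : 0 < μ.real (S i ⁻¹' G) :=
      measureReal_nonneg.lt_of_ne' ((measureReal_ne_zero_iff (measure_ne_top μ _)).2 (hpos i))
    rw [integral_comp_cond_iInter hS hindep hG hpos hφ i, le_div_iff₀ hGpos]
    exact hmean i
  have hφS (i : ι) : Measurable fun ω => φ (S i ω) := hφ.comp (hS i)
  have hevent : MeasurableSet {ω | 0 < ∑ i, φ (S i ω)} :=
    measurableSet_lt measurable_const (Finset.measurable_sum _ fun i _ => hφS i)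
  have hcompl : {ω | 0 < ∑ i, φ (S i ω)}ᶜ = {ω | ∑ i, φ (S i ω) ≤ 0} := by
    ext ω; simp only [mem_compl_iff, mem_ofPred_eq, not_lt]
  have htail := measureReal_sum_nonpos_le_exp (fun i => (hφS i).aemeasurable)
    (hindepG.comp (fun _ => φ) fun _ => hφ) hd hbound hcondmean
  rw [← hcompl, probReal_compl_eq_one_sub hevent] at htail
  linarith

-- Conditioning on the event that the sample stays in `G`, where `φ` is bounded, makes the two
-- failure probabilities combine into a product. A union bound would add them.
theorem prod_mul_one_sub_exp_le_measureReal_sum_pos (hS : ∀ i, Measurable (S i))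
    (hindep : iIndepFun S μ) (hG : MeasurableSet G) {φ : E → ℝ} (hφ : Measurable φ) {B d : ℝ}
    (hd : 0 ≤ d) (hB : ∀ x ∈ G, |φ x| ≤ B)
    (hmean : ∀ i, d * μ.real (S i ⁻¹' G) ≤ ∫ ω in S i ⁻¹' G, φ (S i ω) ∂μ) :
    (∏ i, μ.real (S i ⁻¹' G)) * (1 - Real.exp (-(Fintype.card ι * (d ^ 2 / (2 * B ^ 2))))) ≤
      μ.real {ω | 0 < ∑ i, φ (S i ω)} := by
  by_cases hpos : ∀ i, μ (S i ⁻¹' G) ≠ 0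
  · calc _ ≤ (∏ i, μ.real (S i ⁻¹' G)) *
          (μ[|⋂ i, S i ⁻¹' G]).real {ω | 0 < ∑ i, φ (S i ω)} := by
          gcongr
          exact one_sub_exp_le_cond_real_sum_pos hS hindep hG hpos hφ hd hB hmean
      _ = μ.real ((⋂ i, S i ⁻¹' G) ∩ {ω | 0 < ∑ i, φ (S i ω)}) := by
          simp only [measureReal_def, ← ENNReal.toReal_prod, ← ENNReal.toReal_mul]
          rw [← hindep.meas_iInter fun i => ⟨G, hG, rfl⟩, mul_comm,
            cond_mul_eq_inter (.iInter fun i => hS i hG)]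
      _ ≤ _ := measureReal_mono inter_subset_right
  · push Not at hpos
    obtain ⟨i, hi⟩ := hpos
    rw [Finset.prod_eq_zero (Finset.mem_univ i) (by rw [measureReal_def, hi, ENNReal.toReal_zero]),
      zero_mul]
    exact measureReal_nonneg

end Conditioning

section Finite

variable {X Ω : Type*} [MeasurableSpace X] [MeasurableSingletonClass X] [MeasurableSpace Ω]
  {P : Measure Ω}

theorem measureReal_preimage_finset_eq_sum [IsFiniteMeasure P] {T : Ω → X} (hT : Measurable T)
    {p : X → ℝ} (hlaw : ∀ x, P.real {ω | T ω = x} = p x) (G : Finset X) :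
    P.real (T ⁻¹' G) = ∑ x ∈ G, p x := by
  rw [← sum_measureReal_preimage_singleton G fun x _ => hT (measurableSet_singleton x)]
  exact Finset.sum_congr rfl fun x _ => hlaw x

theorem setIntegral_comp_preimage_finset_eq_sum [IsFiniteMeasure P] {T : Ω → X}
    (hT : Measurable T) {p : X → ℝ} (hlaw : ∀ x, P.real {ω | T ω = x} = p x) {φ : X → ℝ}
    (hφ : Measurable φ) (G : Finset X) :
    ∫ ω in T ⁻¹' G, φ (T ω) ∂P = ∑ x ∈ G, p x * φ x := by
  rw [← setIntegral_map G.measurableSet hφ.aestronglyMeasurable hT.aemeasurable,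
    setIntegral_finset G]
  · refine Finset.sum_congr rfl fun x _ => ?_
    rw [measureReal_def, Measure.map_apply hT (measurableSet_singleton x), smul_eq_mul]
    exact congrArg (· * φ x) (hlaw x)
  · exact IntegrableOn.finset

theorem pow_mul_one_sub_exp_le_measureReal_sum_pos [IsProbabilityMeasure P] {ι : Type*} [Fintype ι]
    {S : ι → Ω → X} (hS : ∀ i, Measurable (S i)) (hindep : iIndepFun S P) {p : X → ℝ}
    (hlaw : ∀ i x, P.real {ω | S i ω = x} = p x) {G : Finset X} {φ : X → ℝ} (hφ : Measurable φ)
    {B d : ℝ} (hd : 0 ≤ d) (hB : ∀ x ∈ G, |φ x| ≤ B) (hmean : d ≤ ∑ x ∈ G, p x * φ x) :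
    (∑ x ∈ G, p x) ^ Fintype.card ι *
        (1 - Real.exp (-(Fintype.card ι * (d ^ 2 / (2 * B ^ 2))))) ≤
      P.real {ω | 0 < ∑ i, φ (S i ω)} := by
  have hmass (i : ι) := measureReal_preimage_finset_eq_sum (hS i) (hlaw i) G
  have hcondmean (i : ι) : d * P.real (S i ⁻¹' G) ≤ ∫ ω in S i ⁻¹' G, φ (S i ω) ∂P := by
    rw [setIntegral_comp_preimage_finset_eq_sum (hS i) (hlaw i) hφ G]
    exact (mul_le_of_le_one_right hd measureReal_le_one).trans hmean
  have := prod_mul_one_sub_exp_le_measureReal_sum_pos hS hindep G.measurableSet hφ hd hB hcondmean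
  simpa only [hmass, Finset.prod_const, Finset.card_univ] using this

end Finite

section Empirical

variable {X : Type*} [Fintype X] {m : ℕ}

theorem sum_empiricalDist_mul (s : Fin m → X) (φ : X → ℝ) :
    ∑ x, empiricalDist s x * φ x = (∑ i, φ (s i)) / m := by
  classical
  rw [← Finset.sum_fiberwise (g := s), Finset.sum_div]
  refine Finset.sum_congr rfl fun x _ => ?_
  rw [Finset.sum_congr rfl fun i hi => congrArg φ (Finset.mem_filter.1 hi).2, Finset.sum_const,
    nsmul_eq_mul, empiricalDist, div_mul_eq_mul_div]

theorem expectedLoss_empiricalDist_lt_iff (hm : m ≠ 0) (f : ℝ → ℝ) (p q : X → ℝ)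
    (s : Fin m → X) :
    expectedLoss (localLoss f) p (empiricalDist s) <
        expectedLoss (localLoss f) q (empiricalDist s) ↔
      0 < ∑ i, excessLoss f p q (s i) := by
  have hm0 : (0 : ℝ) < m := Nat.cast_pos.2 (Nat.pos_of_ne_zero hm)
  simp only [expectedLoss, excessLoss, sum_empiricalDist_mul, Finset.sum_sub_distrib, sub_pos,
    div_lt_div_iff_of_pos_right hm0]

end Empirical

end Sampling

section SampleSize

theorem one_div_sampleBeta (C : ℝ → ℝ) (c : ℝ) (N : ℕ) (ε δ : ℝ) :
    1 / sampleBeta C c N ε δ =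
      δ * min 1 ((C (4 * N / ε) * (ε ^ 2 / (128 * c))) ^ 2) / (288 * (N : ℝ) ^ 8) := by
  rw [sampleBeta, one_div_div]

variable {C : ℝ → ℝ} {c ε δ : ℝ} {m N : ℕ}

theorem sampleBeta_pos (hN : 0 < N) (hε : 0 < ε) (hc : 0 < c) (hC : 0 < C (4 * N / ε))
    (hδ : 0 < δ) : 0 < sampleBeta C c N ε δ := by
  rw [sampleBeta]
  positivity

theorem mul_one_div_sampleBeta_le (hN : 0 < N) (hδ : 0 ≤ δ) (hmN : m ≤ N) :
    m * (2 * N * (1 / sampleBeta C c N ε δ)) ≤ δ / 2 := by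
  have hN1 : (1 : ℝ) ≤ N := Nat.one_le_cast.2 hN
  calc m * (2 * N * (1 / sampleBeta C c N ε δ))
      ≤ N * (2 * N * (δ * 1 / (288 * (N : ℝ) ^ 8))) := by
        rw [one_div_sampleBeta]
        gcongr
        exact min_le_left _ _
    _ = δ / (144 * N ^ 6) := by field_simp; ring
    _ ≤ δ / 2 := by gcongr; linarith [one_le_pow₀ hN1 (n := 6)]

theorem mul_sqrt_one_div_sampleBeta_le (hN : 0 < N) (hc : 0 < c) (hC : 0 ≤ C (4 * N / ε))
    (hδ : δ ∈ Icc (0 : ℝ) 1) :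
    2 * N * c * √(1 / sampleBeta C c N ε δ) ≤ C (4 * N / ε) * ε ^ 2 / 128 := by
  have hN1 : (1 : ℝ) ≤ N := Nat.one_le_cast.2 hN
  set a := C (4 * N / ε) * (ε ^ 2 / (128 * c)) with ha
  have : 0 ≤ a := by positivity
  have hsqrt : √(1 / sampleBeta C c N ε δ) ≤ a / (16 * N ^ 4) := by
    refine Real.sqrt_le_iff.2 ⟨by positivity, ?_⟩
    calc 1 / sampleBeta C c N ε δ ≤ 1 * a ^ 2 / (256 * (N : ℝ) ^ 8) := by
          rw [one_div_sampleBeta]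
          gcongr
          · exact hδ.2
          · exact min_le_right _ _
          · norm_num
      _ = (a / (16 * N ^ 4)) ^ 2 := by ring
  calc 2 * N * c * √(1 / sampleBeta C c N ε δ) ≤ 2 * N * c * (a / (16 * N ^ 4)) := by gcongr
    _ = c * a / (8 * N ^ 3) := by field_simp; ring
    _ ≤ c * a := div_le_self (by positivity) (by linarith [one_le_pow₀ hN1 (n := 3)])
    _ = C (4 * N / ε) * ε ^ 2 / 128 := by rw [ha]; field_simp

theorem one_sub_le_pow_mul_one_sub_exp {σ η e : ℝ} (hσ0 : 0 ≤ σ) (hσ : 1 - η ≤ σ)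
    (hη : m * η ≤ δ / 2) (hδ : δ ∈ Ioo (0 : ℝ) 1) (he : 2 * Real.log (1 / δ) ≤ e) :
    1 - δ ≤ σ ^ m * (1 - Real.exp (-e)) := by
  obtain ⟨hδ0, hδ1⟩ := hδ
  have hexp : Real.exp (-e) ≤ δ ^ 2 := by
    rw [← Real.le_log_iff_exp_le (pow_pos hδ0 2), Real.log_pow]
    rw [one_div, Real.log_inv] at he
    push_cast
    linarith
  have hpow : 1 - δ / 2 ≤ σ ^ m := by
    have hbernoulli := one_add_mul_le_pow (a := σ - 1) (by linarith) m
    rw [add_sub_cancel] at hbernoulli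
    have : (m : ℝ) * (1 - σ) ≤ m * η := by gcongr; linarith
    linarith
  calc 1 - δ ≤ (1 - δ / 2) * (1 - δ ^ 2) := by
        linear_combination mul_nonneg hδ0.le (sq_nonneg (1 - δ)) / 2
    _ ≤ σ ^ m * (1 - Real.exp (-e)) := by
        have : 0 ≤ 1 - δ ^ 2 := by nlinarith
        gcongr

end SampleSize

section SampleProperness

theorem pos_of_abs_le_of_sum_mul_pos {X : Type*} {G : Finset X} {p φ : X → ℝ} {B : ℝ}
    (hp : ∀ x ∈ G, 0 ≤ p x) (hB : ∀ x ∈ G, |φ x| ≤ B) (hpos : 0 < ∑ x ∈ G, p x * φ x) :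
    0 < B := by
  obtain ⟨x, hx, hx0⟩ : ∃ x ∈ G, 0 < p x * φ x :=
    Finset.exists_lt_of_sum_lt (by simpa only [Finset.sum_const_zero] using hpos)
  exact (pos_of_mul_pos_right hx0 (hp x hx)).trans_le ((le_abs_self _).trans (hB x hx))

theorem one_sub_le_measureReal_expectedLoss_lt {X : Type*} [Fintype X] [MeasurableSpace X]
    [MeasurableSingletonClass X] {f : ℝ → ℝ} {c : ℝ} (hf0 : ∀ z ∈ Ici (1 : ℝ), 0 ≤ f z)
    (hmono : MonotoneOn f (Ici 1)) (hf : ∀ z ∈ Ici (1 : ℝ), f z ≤ c * √z) (hc : 0 ≤ c)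
    {p q : X → ℝ} (hp : p ∈ stdSimplex ℝ X) (hq : q ∈ stdSimplex ℝ X) (hcal : IsCalibrated q p)
    {θ d δ : ℝ} (hθ : 0 < θ) (hd : 0 < d) (hδ : δ ∈ Ioo (0 : ℝ) 1)
    (hgap : d + 2 * Fintype.card X * c * √θ ≤ ∑ x, p x * excessLoss f p q x) {m : ℕ}
    (hmθ : m * (2 * Fintype.card X * θ) ≤ δ / 2)
    (hm : 4 * f (1 / θ) ^ 2 * Real.log (1 / δ) / d ^ 2 ≤ m)
    {Ω : Type*} [MeasurableSpace Ω] {P : Measure Ω} [IsProbabilityMeasure P] {S : Fin m → Ω → X}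
    (hS : ∀ i, Measurable (S i)) (hindep : iIndepFun S P)
    (hlaw : ∀ i x, P.real {ω | S i ω = x} = p x) :
    1 - δ ≤ P.real {ω | expectedLoss (localLoss f) p (empiricalDist fun i => S i ω) <
      expectedLoss (localLoss f) q (empiricalDist fun i => S i ω)} := by
  have hmean : d ≤ ∑ x ∈ heavyOutcomes p q θ, p x * excessLoss f p q x :=
    (le_sub_iff_add_le.2 hgap).trans (sum_mul_excessLoss_sub_le hf0 hmono hf hc hp hq hcal hθ)
  have hbound (x : X) (hx : x ∈ heavyOutcomes p q θ) : |excessLoss f p q x| ≤ f (1 / θ) :=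
    abs_excessLoss_le hf0 hmono hp hq hθ hx
  have hB : 0 < f (1 / θ) :=
    pos_of_abs_le_of_sum_mul_pos (fun x _ => hp.1 x) hbound (hd.trans_le hmean)
  have hlog : 0 < Real.log (1 / δ) := Real.log_pos (one_lt_one_div_of_mem_Ioo hδ)
  have hm0 : m ≠ 0 := Nat.cast_ne_zero.1 (lt_of_lt_of_le (by positivity) hm).ne'
  have hexponent : 2 * Real.log (1 / δ) ≤ m * (d ^ 2 / (2 * f (1 / θ) ^ 2)) :=
    calc 2 * Real.log (1 / δ) =
          4 * f (1 / θ) ^ 2 * Real.log (1 / δ) / d ^ 2 * (d ^ 2 / (2 * f (1 / θ) ^ 2)) := by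
          field_simp; norm_num
      _ ≤ m * (d ^ 2 / (2 * f (1 / θ) ^ 2)) := by gcongr
  calc 1 - δ ≤ (∑ x ∈ heavyOutcomes p q θ, p x) ^ m *
          (1 - Real.exp (-(m * (d ^ 2 / (2 * f (1 / θ) ^ 2))))) :=
        one_sub_le_pow_mul_one_sub_exp (Finset.sum_nonneg fun x _ => hp.1 x)
          (one_sub_le_sum_heavyOutcomes hcal hp hq hθ.le) hmθ hδ hexponent
    _ ≤ P.real {ω | 0 < ∑ i, excessLoss f p q (S i ω)} := by
        simpa only [Fintype.card_fin] using pow_mul_one_sub_exp_le_measureReal_sum_pos hS hindep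
          hlaw (measurable_of_finite _) hd.le hbound hmean
    _ = _ := by simp only [expectedLoss_empiricalDist_lt_iff hm0]

end SampleProperness

theorem mainTheorem4 :
    ∃ c₁ : ℝ, 0 < c₁ ∧
      ∀ (X : Type*) [Fintype X] [MeasurableSpace X] [MeasurableSingletonClass X]
        (f C : ℝ → ℝ) (c : ℝ),
        (∀ z ∈ Ici (1 : ℝ), 0 ≤ f z) →
        MonotoneOn f (Ici 1) →
        ConcaveOn ℝ (Ici 1) f →
        (∀ z ∈ Ici (1 : ℝ), f z ≤ c * √z) →
        (∀ z ∈ Ici (1 : ℝ), 0 ≤ C z) →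
        AntitoneOn C (Ici 1) →
        LeftStronglyConcaveOn (Ici 1) (fun z => C z / z ^ 2) f →
        ∀ p ∈ stdSimplex ℝ X, ∀ q ∈ stdSimplex ℝ X,
          IsCalibrated q p → p ≠ q →
          0 < C (4 * (Fintype.card X : ℝ) / l1Dist p q) →
          ∀ δ ∈ Ioo (0 : ℝ) 1, ∀ m : ℕ, m ≤ Fintype.card X →
            c₁ * f (sampleBeta C c (Fintype.card X) (l1Dist p q) δ) ^ 2 * Real.log (1 / δ) /
                (C (4 * (Fintype.card X : ℝ) / l1Dist p q) * l1Dist p q ^ 2) ^ 2 ≤ (m : ℝ) →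
            ∀ (Ω : Type*) [MeasurableSpace Ω] (P : Measure Ω) [IsProbabilityMeasure P]
              (S : Fin m → Ω → X),
              (∀ i, Measurable (S i)) →
              iIndepFun S P →
              (∀ i x, P.real {ω | S i ω = x} = p x) →
              1 - δ ≤ P.real {ω |
                expectedLoss (localLoss f) p (empiricalDist (fun i => S i ω)) <
                  expectedLoss (localLoss f) q (empiricalDist (fun i => S i ω))} := by
  refine ⟨4 * 128 ^ 2, by norm_num, ?_⟩
  intro X _ _ _ f C c hf0 hmono hconc hf _ hC hstrong p hp q hq hcal hne hC0 δ hδ m hmN hm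
    Ω _ P _ S hS hindep hlaw
  have hε : 0 < l1Dist p q := l1Dist_pos hne
  have hN : 0 < Fintype.card X := by
    obtain ⟨x, -⟩ := Function.ne_iff.1 hne
    exact Fintype.card_pos_iff.2 ⟨x⟩
  have hproper := strong_properness hmono hconc hC hstrong hp hq hcal hne hC0.le
  have hc : 0 < c :=
    pos_of_sum_mul_excessLoss_pos hf0 hf hp hq hcal (lt_of_lt_of_le (by positivity) hproper)
  have htrunc := mul_sqrt_one_div_sampleBeta_le hN hc hC0.le (Ioo_subset_Icc_self hδ)
  refine one_sub_le_measureReal_expectedLoss_lt hf0 hmono hf hc.le hp hq hcal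
    (d := C (4 * Fintype.card X / l1Dist p q) * l1Dist p q ^ 2 / 128)
    (one_div_pos.2 (sampleBeta_pos hN hε hc hC0 hδ.1)) (by positivity) hδ (by linarith)
    (mul_one_div_sampleBeta_le hN hδ.1.le hmN) ?_ hS hindep hlaw
  rw [one_div_one_div]
  exact hm.trans_eq' (by ring)
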